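/- Let $(X,\mathscr A,\mu)$ be a $\sigma$-finite measure space, let $\phi\colon X\to X$ be $\mathscr A$-measurable with $\mu\circ\phi^{-1}\ll\mu$, and let $w\colon X\to\mathbb C$ be $\mathscr A$-measurable. In the complex Hilbert space $L^2(\mu)$ consider the composition operator $C_\phi f=f\circ\phi$ with domain $\mathcal D(C_\phi)=\{f\in L^2(\mu): f\circ\phi\in L^2(\mu)\}$ and the multiplication operator $M_wf=wf$ with domain $\mathcal D(M_w)=\{f\in L^2(\mu): wf\in L^2(\mu)\}$; products of operators carry their maximal domains, $\mathcal D(BA)=\{f\in\mathcal D(A): Af\in\mathcal D(B)\}$. For $f\in L^2(\mu)$ let $\mathsf E_\phi(f)$ be the conditional expectation of $f$ with respect to the $\sigma$-algebra $\phi^{-1}(\mathscr A)$ and the measure $\mu$. For an operator $T$ in a Hilbert space, with kernel $\mathcal N(T)$ and range $\mathcal R(T)$, such that $\mathcal D(T)=\mathcal N(T)\oplus\big(\mathcal D(T)\cap\mathcal N(T)^\perp\big)$, the reciprocal $T^\dag$ of $T$ is the unique operator with domain $\mathcal D(T^\dag)=\mathcal R(T)\oplus\mathcal R(T)^\perp$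 such that $TT^\dag f=P_{\overline{\mathcal R(T)}}f$ for $f\in\mathcal D(T^\dag)$, $T^\dag Tg=P_{\mathcal N(T)^\perp}g$ for $g\in\mathcal D(T)$, and $\mathcal N(T^\dag)=\mathcal R(T)^\perp$. Assume that $C_\phi$ is densely defined. Then $C_\phi$ and $M_w$ have reciprocals. If, moreover, $$\{f\in L^2(\mu): \mathsf E_\phi(f)=0\ \text{a.e. }[\mu]\}=\mathcal N(M_w),$$ then $M_wC_\phi$ has a reciprocal and $(M_wC_\phi)^\dag=C_\phi^\dag M_w^\dag$. In particular, if $w\neq0$ a.e. $[\mu]$ and $\overline{\mathcal R(C_\phi)}=L^2(\mu)$, then $M_wC_\phi$ has a reciprocal and $(M_wC_\phi)^\dag=C_\phi^\dag M_w^\dag$. -/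

import Mathlib

open MeasureTheory
open scoped ENNReal

noncomputable section

namespace PartialOp

variable {H : Type*} [NormedAddCommGroup H] [InnerProductSpace ℂ H]

/-- The kernel `N(T)` of an operator `T` in `H`, as a subspace of `H`. -/
def ker (T : H →ₗ.[ℂ] H) : Submodule ℂ H :=
  (LinearMap.ker T.toFun).map T.domain.subtype

/-- The range `R(T)` of an operator `T` in `H`. -/
def ran (T : H →ₗ.[ℂ] H) : Submodule ℂ H :=
  LinearMap.range T.toFun

/-- The product `B A` of two operators in `H`, with its maximal domain
`D(BA) = {f ∈ D(A) : A f ∈ D(B)}`. -/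
def mul (B A : H →ₗ.[ℂ] H) : H →ₗ.[ℂ] H where
  domain := (B.domain.comap A.toFun).map A.domain.subtype
  toFun :=
    { toFun := fun f => B ⟨A ⟨f.1, by obtain ⟨g, -, hg⟩ := f.2; rw [← hg]; exact g.2⟩, by
        obtain ⟨_, g, hg, rfl⟩ := f
        exact hg⟩
      map_add' := fun f g => by
        rw [← LinearPMap.map_add]
        congr 1
        ext1
        exact LinearPMap.map_add A ⟨f.1, _⟩ ⟨g.1, _⟩
      map_smul' := fun c f => by
        rw [RingHom.id_apply, ← LinearPMap.map_smul]
        congr 1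
        ext1
        exact LinearPMap.map_smul A c ⟨f.1, _⟩ }

theorem mem_mul_domain (B A : H →ₗ.[ℂ] H) (f : H) :
    f ∈ (mul B A).domain ↔ ∃ h : f ∈ A.domain, A ⟨f, h⟩ ∈ B.domain := by
  constructor
  · rintro ⟨g, hg, rfl⟩
    exact ⟨g.2, hg⟩
  · rintro ⟨h, hB⟩
    exact ⟨⟨f, h⟩, hB, rfl⟩

variable [CompleteSpace H]

/-- `IsReciprocal T S`: the domain of `T` decomposes as `N(T) ⊕ (D(T) ∩ N(T)ᗮ)`, and `S` is the
reciprocal (maximal Tseng inverse) of `T`. -/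
structure IsReciprocal (T S : H →ₗ.[ℂ] H) : Prop where
  /-- `D(T) = N(T) ⊕ (D(T) ∩ N(T)ᗮ)`; the sum is automatically orthogonal. -/
  decomp : T.domain = ker T ⊔ (T.domain ⊓ (ker T)ᗮ)
  /-- `D(S) = R(T) ⊕ R(T)ᗮ`. -/
  domain_eq : S.domain = ran T ⊔ (ran T)ᗮ
  /-- `T S f` is defined and equal to the projection of `f` onto the closure of `R(T)`. -/
  apply_right : ∀ f : S.domain, ∃ h : S f ∈ T.domain,
    T ⟨S f, h⟩ = (ran T).topologicalClosure.starProjection (f : H)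
  /-- `S T g` is defined and equal to the projection of `g` onto `N(T)ᗮ`. -/
  apply_left : ∀ g : T.domain, ∃ h : T g ∈ S.domain,
    S ⟨T g, h⟩ = (ker T)ᗮ.starProjection (g : H)
  /-- `N(S) = R(T)ᗮ`. -/
  ker_eq : ker S = (ran T)ᗮ

theorem IsReciprocal.unique {T S S' : H →ₗ.[ℂ] H} (h : IsReciprocal T S)
    (h' : IsReciprocal T S') : S = S' := by
  refine LinearPMap.ext (h.domain_eq.trans h'.domain_eq.symm) ?_
  intro x hx hx'
  obtain ⟨_, ⟨g, rfl⟩, r, hr, rfl⟩ := Submodule.mem_sup.1 (h.domain_eq ▸ hx)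
  have key : ∀ {R : H →ₗ.[ℂ] H} (hR : IsReciprocal T R) (hx : T.toFun g + r ∈ R.domain),
      R ⟨T.toFun g + r, hx⟩ = (ker T)ᗮ.starProjection (g : H) := by
    intro R hR hx
    obtain ⟨h1, h2⟩ := hR.apply_left g
    obtain ⟨r', hr', e⟩ := hR.ker_eq.symm ▸ hr
    subst e
    have e2 : (⟨T.toFun g + R.domain.subtype r', hx⟩ : R.domain) = ⟨T g, h1⟩ + r' := rfl
    have e3 : R r' = 0 := hr'
    rw [e2, LinearPMap.map_add, h2, e3, add_zero]
  rw [key h hx, key h' hx']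

/-- `T` has a reciprocal. -/
def HasReciprocal (T : H →ₗ.[ℂ] H) : Prop :=
  ∃ S, IsReciprocal T S

open Classical in
/-- The reciprocal `T†` of `T`: the unique operator `S` with `IsReciprocal T S`
(a meaningless value if there is none). -/
def reciprocal (T : H →ₗ.[ℂ] H) : H →ₗ.[ℂ] H :=
  if h : HasReciprocal T then h.choose else ⊥

end PartialOp

section L2Operators

variable {X : Type*} [MeasurableSpace X] {μ : Measure X}

/-- The multiplication operator `M_w f = w f` in `L²(μ)`, with
`D(M_w) = {f ∈ L²(μ) : w f ∈ L²(μ)}`. -/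
def mulOp (μ : Measure X) (w : X → ℂ) : Lp ℂ 2 μ →ₗ.[ℂ] Lp ℂ 2 μ where
  domain :=
    { carrier := {f | MemLp (fun x => w x * f x) 2 μ}
      zero_mem' := by
        refine (MemLp.zero (ε := ℂ)).ae_eq ?_
        filter_upwards [Lp.coeFn_zero ℂ 2 μ] with x hx
        simp only [hx, Pi.zero_apply, mul_zero]
      add_mem' := fun {f g} hf hg => by
        refine (MemLp.add hf hg).ae_eq ?_
        filter_upwards [Lp.coeFn_add f g] with x hx
        simp only [hx, Pi.add_apply, mul_add]
      smul_mem' := fun c f hf => by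
        refine (MemLp.const_smul hf c).ae_eq ?_
        filter_upwards [Lp.coeFn_smul c f] with x hx
        simp only [hx, Pi.smul_apply, smul_eq_mul]
        ring }
  toFun :=
    { toFun := fun f => MemLp.toLp (fun x => w x * f.1 x) f.2
      map_add' := fun f g => by
        rw [← MemLp.toLp_add]
        refine MemLp.toLp_congr _ _ ?_
        filter_upwards [Lp.coeFn_add f.1 g.1] with x hx
        simp only [hx, Pi.add_apply, Submodule.coe_add, mul_add]
      map_smul' := fun c f => by
        rw [RingHom.id_apply, ← MemLp.toLp_const_smul]
        refine MemLp.toLp_congr _ _ ?_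
        filter_upwards [Lp.coeFn_smul c f.1] with x hx
        simp only [Submodule.coe_smul, hx, Pi.smul_apply, smul_eq_mul]
        ring }

/-- The composition operator `C_φ f = f ∘ φ` in `L²(μ)`, with
`D(C_φ) = {f ∈ L²(μ) : f ∘ φ ∈ L²(μ)}`. It is well-defined on a.e.-classes because `φ` is
measurable and `μ ∘ φ⁻¹ ≪ μ`. -/
def compOp {φ : X → X} (hφ : Measure.QuasiMeasurePreserving φ μ μ) :
    Lp ℂ 2 μ →ₗ.[ℂ] Lp ℂ 2 μ where
  domain :=
    { carrier := {f | MemLp (fun x => f (φ x)) 2 μ}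
      zero_mem' := by
        refine (MemLp.zero (ε := ℂ)).ae_eq ?_
        filter_upwards [hφ.ae (Lp.coeFn_zero ℂ 2 μ)] with x hx
        simp only [hx, Pi.zero_apply]
      add_mem' := fun {f g} hf hg => by
        refine (MemLp.add hf hg).ae_eq ?_
        filter_upwards [hφ.ae (Lp.coeFn_add f g)] with x hx
        simp only [hx, Pi.add_apply]
      smul_mem' := fun c f hf => by
        refine (MemLp.const_smul hf c).ae_eq ?_
        filter_upwards [hφ.ae (Lp.coeFn_smul c f)] with x hx
        simp only [hx, Pi.smul_apply] }
  toFun :=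
    { toFun := fun f => MemLp.toLp (fun x => f.1 (φ x)) f.2
      map_add' := fun f g => by
        rw [← MemLp.toLp_add]
        refine MemLp.toLp_congr _ _ ?_
        filter_upwards [hφ.ae (Lp.coeFn_add f.1 g.1)] with x hx
        simp only [hx, Pi.add_apply, Submodule.coe_add]
      map_smul' := fun c f => by
        rw [RingHom.id_apply, ← MemLp.toLp_const_smul]
        refine MemLp.toLp_congr _ _ ?_
        filter_upwards [hφ.ae (Lp.coeFn_smul c f.1)] with x hx
        simp only [hx, Pi.smul_apply, Submodule.coe_smul] }

/-- The conditional expectation `E_φ(f)` of `f ∈ L²(μ)` with respect to the σ-algebra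
`φ⁻¹(𝒜) = {φ⁻¹(A) : A ∈ 𝒜}` and the measure `μ`. -/
def condExpMap {φ : X → X} (hφ : Measure.QuasiMeasurePreserving φ μ μ) (f : Lp ℂ 2 μ) :
    Lp ℂ 2 μ :=
  (condExpL2 ℂ ℂ (m := MeasurableSpace.comap φ inferInstance) hφ.measurable.comap_le f :
    Lp ℂ 2 μ)

end L2Operators

end

/-! ### Reciprocals of operators with closed kernel. -/

namespace PartialOp

variable {H : Type*} [NormedAddCommGroup H] [InnerProductSpace ℂ H]

/-! Every operator with closed kernel has a reciprocal (`hasReciprocal_of_isClosed_ker`): send `T g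
+ r`, with `r ⟂ R(T)`, to the projection of `g` onto `N(T)ᗮ`. The kernels of `M_w` and `C_φ` are
closed because `L²` convergence yields a.e. convergence along a subsequence.

Both hypotheses for the product formula lead to one situation: `w ≠ 0` a.e., and every `f ∈ L²(μ)`
agrees a.e. with some measurable `g ∘ φ`. Under the conditional expectation hypothesis, indicators
of subsets of `{w = 0}` show `w ≠ 0` a.e.; then `N(M_w) = 0`, so the projection `E_φ` is injective,
hence the identity. If `R(C_φ)` is dense, all of `L²(μ)` is `φ⁻¹(𝒜)`-measurable.

In that situation `M_w` is injective, and `C_φ` and `M_w C_φ` have dense range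
(`mul_ae_eq_zero_of_orthogonal`). The domains of the reciprocals are then just the ranges, `M_w†` is
the inverse of `M_w`, and the reverse order law `IsReciprocal.mul` becomes a direct check. -/

theorem mem_ker {T : H →ₗ.[ℂ] H} {f : H} : f ∈ ker T ↔ ∃ h : f ∈ T.domain, T ⟨f, h⟩ = 0 := by
  constructor
  · rintro ⟨g, hg, rfl⟩
    exact ⟨g.2, hg⟩
  · rintro ⟨h, hT⟩
    exact ⟨⟨f, h⟩, hT, rfl⟩

theorem mem_ran {T : H →ₗ.[ℂ] H} {f : H} : f ∈ ran T ↔ ∃ g : T.domain, T g = f := Iff.rfl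

theorem ker_le_domain (T : H →ₗ.[ℂ] H) : ker T ≤ T.domain := fun _ hf => (mem_ker.1 hf).1

theorem mul_apply {B A : H →ₗ.[ℂ] H} {f : H} (h : f ∈ (mul B A).domain) (hA : f ∈ A.domain)
    (hB : A ⟨f, hA⟩ ∈ B.domain) : mul B A ⟨f, h⟩ = B ⟨A ⟨f, hA⟩, hB⟩ := rfl

theorem eq_zero_of_add_eq_zero {T : H →ₗ.[ℂ] H} {g : T.domain} {r : H} (hr : r ∈ (ran T)ᗮ)
    (h : T g + r = 0) : T g = 0 := by
  have h1 : T g ∈ (ran T)ᗮ := by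
    rw [eq_neg_of_add_eq_zero_left h]
    exact Submodule.neg_mem _ hr
  exact inner_self_eq_zero.1 (h1 (T g) ⟨g, rfl⟩)

theorem ran_mul_le (B A : H →ₗ.[ℂ] H) : ran (mul B A) ≤ ran B := by
  rintro _ ⟨⟨f, hf⟩, rfl⟩
  obtain ⟨hA, hB⟩ := (mem_mul_domain B A f).1 hf
  exact ⟨⟨_, hB⟩, rfl⟩

variable [CompleteSpace H]

/-- The projection of a vector of the domain onto `N(T)ᗮ` stays in the domain and has the same
image, provided that `N(T)` is closed. -/
theorem exists_apply_starProjection_eq {T : H →ₗ.[ℂ] H} (hT : IsClosed (ker T : Set H))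
    (g : T.domain) : ∃ h : (ker T)ᗮ.starProjection (g : H) ∈ T.domain, T ⟨_, h⟩ = T g := by
  have : CompleteSpace (ker T) := hT.completeSpace_coe
  obtain ⟨hk, hk0⟩ := mem_ker.1 ((ker T).starProjection_apply_mem (g : H))
  have e : (ker T)ᗮ.starProjection (g : H) = g - (ker T).starProjection (g : H) := by
    rw [Submodule.starProjection_orthogonal']
    rfl
  have hmem : (ker T)ᗮ.starProjection (g : H) ∈ T.domain := by
    rw [e]
    exact T.domain.sub_mem g.2 hk
  refine ⟨hmem, ?_⟩
  have : (⟨_, hmem⟩ : T.domain) = g - ⟨_, hk⟩ := Subtype.ext e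
  rw [this, LinearPMap.map_sub, hk0, sub_zero]

theorem domain_eq_of_isClosed_ker {T : H →ₗ.[ℂ] H} (hT : IsClosed (ker T : Set H)) :
    T.domain = ker T ⊔ (T.domain ⊓ (ker T)ᗮ) := by
  have : CompleteSpace (ker T) := hT.completeSpace_coe
  refine le_antisymm (fun g hg => ?_) (sup_le (ker_le_domain T) inf_le_left)
  obtain ⟨h, -⟩ := exists_apply_starProjection_eq hT ⟨g, hg⟩
  refine Submodule.mem_sup.2 ⟨_, (ker T).starProjection_apply_mem g, _,
    ⟨h, Submodule.starProjection_apply_mem _ _⟩, ?_⟩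
  exact Submodule.starProjection_add_starProjection_orthogonal g

/-- The graph of the reciprocal of `T`. -/
noncomputable def reciprocalGraph (T : H →ₗ.[ℂ] H) : Submodule ℂ (H × H) :=
  LinearMap.range
    ((LinearMap.coprod T.toFun (ran T)ᗮ.subtype).prod
      (((ker T)ᗮ.starProjection : H →ₗ[ℂ] H) ∘ₗ T.domain.subtype ∘ₗ LinearMap.fst ℂ _ _))

theorem mem_reciprocalGraph {T : H →ₗ.[ℂ] H} {p : H × H} :
    p ∈ reciprocalGraph T ↔ ∃ g : T.domain, ∃ r ∈ (ran T)ᗮ,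
      T g + r = p.1 ∧ (ker T)ᗮ.starProjection (g : H) = p.2 := by
  constructor
  · rintro ⟨⟨g, r⟩, rfl⟩
    exact ⟨g, r, r.2, rfl, rfl⟩
  · rintro ⟨g, r, hr, h1, h2⟩
    exact ⟨(g, ⟨r, hr⟩), Prod.ext h1 h2⟩

/-- Single-valuedness of the graph: `T g + r = 0` puts `g` in `N(T) ⊆ N(T)ᗮᗮ`, which the projection
onto `N(T)ᗮ` kills. -/
theorem eq_zero_of_mem_reciprocalGraph {T : H →ₗ.[ℂ] H} (p : H × H)
    (hp : p ∈ reciprocalGraph T) (h0 : p.1 = 0) : p.2 = 0 := by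
  obtain ⟨g, r, hr, h1, h2⟩ := mem_reciprocalGraph.1 hp
  rw [← h2, Submodule.starProjection_apply_eq_zero_iff]
  exact Submodule.le_orthogonal_orthogonal _
    (mem_ker.2 ⟨g.2, eq_zero_of_add_eq_zero hr (h1.trans h0)⟩)

/-- An operator with closed kernel has a reciprocal. -/
theorem hasReciprocal_of_isClosed_ker {T : H →ₗ.[ℂ] H} (hT : IsClosed (ker T : Set H)) :
    HasReciprocal T := by
  set S := (reciprocalGraph T).toLinearPMap
  have hgr : S.graph = reciprocalGraph T :=
    Submodule.toLinearPMap_graph_eq _ eq_zero_of_mem_reciprocalGraph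
  have hmem : ∀ {f : H}, f ∈ S.domain ↔ ∃ g : T.domain, ∃ r ∈ (ran T)ᗮ, T g + r = f := by
    intro f
    rw [LinearPMap.mem_domain_iff]
    constructor
    · rintro ⟨y, hy⟩
      obtain ⟨g, r, hr, h, -⟩ := mem_reciprocalGraph.1 (hgr ▸ hy)
      exact ⟨g, r, hr, h⟩
    · rintro ⟨g, r, hr, h⟩
      exact ⟨_, hgr ▸ mem_reciprocalGraph.2 ⟨g, r, hr, h, rfl⟩⟩
  have happ : ∀ (g : T.domain) (r : H), r ∈ (ran T)ᗮ → ∀ h : T g + r ∈ S.domain,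
      S ⟨_, h⟩ = (ker T)ᗮ.starProjection (g : H) := by
    intro g r hr h
    exact ((LinearPMap.mem_graph_iff' S).1
      (hgr ▸ mem_reciprocalGraph.2 ⟨g, r, hr, rfl, rfl⟩ :
        (T g + r, (ker T)ᗮ.starProjection (g : H)) ∈ S.graph)).elim
      fun y hy => by
        obtain ⟨e1, e2⟩ := Prod.ext_iff.1 hy
        rw [← (show S y = (ker T)ᗮ.starProjection (g : H) from e2)]
        exact congrArg S (Subtype.ext e1.symm)
  refine ⟨S, domain_eq_of_isClosed_ker hT, ?_, ?_, ?_, ?_⟩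
  · ext f
    rw [hmem, Submodule.mem_sup]
    constructor
    · rintro ⟨g, r, hr, h⟩
      exact ⟨T g, ⟨g, rfl⟩, r, hr, h⟩
    · rintro ⟨_, ⟨g, rfl⟩, r, hr, h⟩
      exact ⟨g, r, hr, h⟩
  · rintro ⟨f, hf⟩
    obtain ⟨g, r, hr, rfl⟩ := hmem.1 hf
    obtain ⟨h, hg⟩ := exists_apply_starProjection_eq hT g
    have e := happ g r hr hf
    refine ⟨e ▸ h, ?_⟩
    -- `r` is also orthogonal to the closure of `R(T)`, so only `T g` survives.
    have e' : (ran T).topologicalClosure.starProjection (T g + r) = T g :=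
      Submodule.eq_starProjection_of_mem_orthogonal'
        ((ran T).le_topologicalClosure (mem_ran.2 ⟨g, rfl⟩))
        (by rwa [Submodule.orthogonal_closure]) rfl
    exact ((congrArg T (Subtype.ext e)).trans hg).trans e'.symm
  · intro g
    have h : T g + 0 ∈ S.domain := hmem.2 ⟨g, 0, Submodule.zero_mem _, rfl⟩
    refine ⟨by simpa using h, ?_⟩
    rw [← happ g 0 (Submodule.zero_mem _) h]
    exact congrArg S (Subtype.ext (add_zero _).symm)
  · ext f
    rw [mem_ker]
    constructor
    · rintro ⟨hf, h0⟩
      obtain ⟨g, r, hr, rfl⟩ := hmem.1 hf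
      rw [happ g r hr hf] at h0
      obtain ⟨h, hg⟩ := exists_apply_starProjection_eq hT g
      have : T g = 0 := by
        rw [← hg, ← LinearPMap.map_zero T]
        exact congrArg T (Subtype.ext h0)
      rwa [this, zero_add]
    · intro hf
      have h : T 0 + f ∈ S.domain := hmem.2 ⟨0, f, hf, rfl⟩
      have e : T 0 + f = f := by rw [LinearPMap.map_zero, zero_add]
      refine ⟨e ▸ h, ?_⟩
      have := happ 0 f hf h
      rw [Submodule.coe_zero, map_zero] at this
      rw [← this]
      exact congrArg S (Subtype.ext e.symm)

/-! ### The reverse order law. -/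

theorem isReciprocal_reciprocal {T : H →ₗ.[ℂ] H} (h : HasReciprocal T) :
    IsReciprocal T (reciprocal T) := by
  rw [reciprocal, dif_pos h]
  exact h.choose_spec

theorem IsReciprocal.reciprocal_eq {T S : H →ₗ.[ℂ] H} (h : IsReciprocal T S) :
    reciprocal T = S :=
  (isReciprocal_reciprocal ⟨S, h⟩).unique h

/-- Reverse order law for reciprocals: `S_A S_B` is the reciprocal of `B A` if `B` is injective and
both `A` and `B A` have dense range. -/
theorem IsReciprocal.mul {A B S_A S_B : H →ₗ.[ℂ] H} (hA : IsReciprocal A S_A)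
    (hB : IsReciprocal B S_B) (hkA : IsClosed (ker A : Set H)) (hkB : ker B = ⊥)
    (hrA : (ran A)ᗮ = ⊥) (hrBA : (ran (PartialOp.mul B A))ᗮ = ⊥) :
    IsReciprocal (PartialOp.mul B A) (PartialOp.mul S_A S_B) := by
  have hrB : (ran B)ᗮ = ⊥ :=
    eq_bot_iff.2 (hrBA ▸ Submodule.orthogonal_le (ran_mul_le B A))
  have hk : ker (PartialOp.mul B A) = ker A := by
    ext f
    simp only [mem_ker]
    constructor
    · rintro ⟨h, h0⟩
      obtain ⟨h1, h2⟩ := (mem_mul_domain B A f).1 h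
      have : A ⟨f, h1⟩ ∈ ker B := mem_ker.2 ⟨h2, h0⟩
      rw [hkB] at this
      exact ⟨h1, this⟩
    · rintro ⟨h1, h0⟩
      have h2 : A ⟨f, h1⟩ ∈ B.domain := h0 ▸ B.domain.zero_mem
      refine ⟨(mem_mul_domain B A f).2 ⟨h1, h2⟩, ?_⟩
      rw [mul_apply _ h1 h2, ← LinearPMap.map_zero B]
      exact congrArg B (Subtype.ext h0)
  have hSBdom : S_B.domain = ran B := by rw [hB.domain_eq, hrB, sup_bot_eq]
  have hSAdom : S_A.domain = ran A := by rw [hA.domain_eq, hrA, sup_bot_eq]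
  -- As `N(B) = 0`, the projection onto `N(B)ᗮ` is the identity and `S_B` inverts `B`.
  have hSB : ∀ (g : B.domain) (h : B g ∈ S_B.domain), S_B ⟨B g, h⟩ = g := by
    intro g h
    obtain ⟨_, e⟩ := hB.apply_left g
    rw [e, Submodule.starProjection_eq_self_iff, hkB, Submodule.bot_orthogonal_eq_top]
    trivial
  have hmem : ∀ {f : H}, f ∈ (PartialOp.mul S_A S_B).domain ↔ f ∈ ran (PartialOp.mul B A) := by
    intro f
    rw [mem_mul_domain]
    constructor
    · rintro ⟨h1, h2⟩
      obtain ⟨g, rfl⟩ := mem_ran.1 (hSBdom ▸ h1)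
      rw [hSB g h1, hSAdom] at h2
      obtain ⟨a, ha⟩ := mem_ran.1 h2
      have hd : A a ∈ B.domain := ha ▸ g.2
      exact ⟨⟨a, (mem_mul_domain B A a).2 ⟨a.2, hd⟩⟩, congrArg B (Subtype.ext ha)⟩
    · rintro ⟨⟨a, ha⟩, rfl⟩
      obtain ⟨h1, h2⟩ := (mem_mul_domain B A a).1 ha
      have h3 : B ⟨_, h2⟩ ∈ S_B.domain := hSBdom ▸ mem_ran.2 ⟨_, rfl⟩
      refine ⟨h3, ?_⟩
      have := hSB _ h3
      refine (congrArg (· ∈ S_A.domain) this).mpr ?_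
      exact hSAdom ▸ mem_ran.2 ⟨_, rfl⟩
  have happ : ∀ (a : (PartialOp.mul B A).domain)
      (h : PartialOp.mul B A a ∈ (PartialOp.mul S_A S_B).domain),
      PartialOp.mul S_A S_B ⟨_, h⟩ = (ker A)ᗮ.starProjection (a : H) := by
    rintro ⟨a, ha⟩ h
    obtain ⟨h1, h2⟩ := (mem_mul_domain B A a).1 ha
    obtain ⟨h3, h4⟩ := (mem_mul_domain _ _ _).1 h
    obtain ⟨h5, h6⟩ := hA.apply_left ⟨a, h1⟩
    rw [mul_apply h h3 h4, ← h6]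
    exact congrArg S_A (Subtype.ext (hSB ⟨_, h2⟩ h3))
  have hproj : ∀ a : (PartialOp.mul B A).domain,
      ∃ h : (ker A)ᗮ.starProjection (a : H) ∈ (PartialOp.mul B A).domain,
        PartialOp.mul B A ⟨_, h⟩ = PartialOp.mul B A a := by
    have := fun a => exists_apply_starProjection_eq (T := PartialOp.mul B A) (hk ▸ hkA) a
    simpa only [hk] using this
  refine ⟨domain_eq_of_isClosed_ker (hk ▸ hkA), ?_, ?_, ?_, ?_⟩
  · rw [hrBA, sup_bot_eq]
    ext f
    exact hmem
  · rintro ⟨f, hf⟩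
    obtain ⟨a, rfl⟩ := mem_ran.1 (hmem.1 hf)
    obtain ⟨h, e⟩ := hproj a
    have e2 := happ a hf
    refine ⟨e2 ▸ h, ?_⟩
    have e3 : (ran (PartialOp.mul B A)).topologicalClosure.starProjection
        (PartialOp.mul B A a) = PartialOp.mul B A a := by
      rw [Submodule.starProjection_eq_self_iff]
      exact Submodule.le_topologicalClosure _ ⟨a, rfl⟩
    exact ((congrArg (PartialOp.mul B A) (Subtype.ext e2)).trans e).trans e3.symm
  · intro a
    refine ⟨hmem.2 ⟨a, rfl⟩, ?_⟩
    rw [happ a, hk]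
  -- If the projection of `a` onto `N(A)ᗮ` is zero, then so is `B A a`, since `B A` takes the same
  -- value at both.
  · rw [hrBA, eq_bot_iff]
    intro f hf
    obtain ⟨h, h0⟩ := mem_ker.1 hf
    obtain ⟨a, rfl⟩ := mem_ran.1 (hmem.1 h)
    obtain ⟨h', e⟩ := hproj a
    rw [Submodule.mem_bot, ← e, ← LinearPMap.map_zero (PartialOp.mul B A)]
    exact congrArg (PartialOp.mul B A) (Subtype.ext ((happ a h).symm.trans h0))

end PartialOp

/-! ### Kernels of `M_w` and `C_φ`. -/

namespace MeasureTheory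

open Filter Topology

variable {X : Type*} [MeasurableSpace X] {μ : Measure X}

theorem mulOp_apply_ae {w : X → ℂ} (f : (mulOp μ w).domain) :
    mulOp μ w f =ᵐ[μ] fun x => w x * (f : Lp ℂ 2 μ) x :=
  MemLp.coeFn_toLp f.2

theorem compOp_apply_ae {φ : X → X} {hφ : Measure.QuasiMeasurePreserving φ μ μ}
    (f : (compOp hφ).domain) : compOp hφ f =ᵐ[μ] fun x => (f : Lp ℂ 2 μ) (φ x) :=
  MemLp.coeFn_toLp f.2

theorem Lp.eq_zero_of_ae {f : Lp ℂ 2 μ} (h : ∀ᵐ x ∂μ, f x = 0) : f = 0 :=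
  (Lp.eq_zero_iff_ae_eq_zero).2 h

theorem Lp.ae_of_eq_zero {f : Lp ℂ 2 μ} (h : f = 0) : ∀ᵐ x ∂μ, f x = 0 :=
  (Lp.eq_zero_iff_ae_eq_zero).1 h

theorem mem_ker_mulOp {w : X → ℂ} {f : Lp ℂ 2 μ} :
    f ∈ PartialOp.ker (mulOp μ w) ↔ ∀ᵐ x ∂μ, w x * f x = 0 := by
  constructor
  · rintro ⟨g, hg, rfl⟩
    filter_upwards [Lp.ae_of_eq_zero hg, mulOp_apply_ae g] with x h1 h2
    exact h2.symm.trans h1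
  · intro h
    have hd : f ∈ (mulOp μ w).domain := (MemLp.zero (ε := ℂ)).ae_eq (h.mono fun x hx => hx.symm)
    refine ⟨⟨f, hd⟩, Lp.eq_zero_of_ae ?_, rfl⟩
    filter_upwards [h, mulOp_apply_ae ⟨f, hd⟩] with x h1 h2
    exact h2.trans h1

theorem mem_ker_compOp {φ : X → X} {hφ : Measure.QuasiMeasurePreserving φ μ μ} {f : Lp ℂ 2 μ} :
    f ∈ PartialOp.ker (compOp hφ) ↔ ∀ᵐ x ∂μ, f (φ x) = 0 := by
  constructor
  · rintro ⟨g, hg, rfl⟩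
    filter_upwards [Lp.ae_of_eq_zero hg, compOp_apply_ae g] with x h1 h2
    exact h2.symm.trans h1
  · intro h
    have hd : f ∈ (compOp hφ).domain := (MemLp.zero (ε := ℂ)).ae_eq (h.mono fun x hx => hx.symm)
    refine ⟨⟨f, hd⟩, Lp.eq_zero_of_ae ?_, rfl⟩
    filter_upwards [h, compOp_apply_ae ⟨f, hd⟩] with x h1 h2
    exact h2.trans h1

theorem Lp.exists_subseq_tendsto_ae {f : ℕ → Lp ℂ 2 μ} {g : Lp ℂ 2 μ}
    (h : Tendsto f atTop (𝓝 g)) :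
    ∃ ns : ℕ → ℕ, ∀ᵐ x ∂μ, Tendsto (fun i => f (ns i) x) atTop (𝓝 (g x)) := by
  obtain ⟨ns, -, hns⟩ := (tendstoInMeasure_of_tendsto_Lp h).exists_seq_tendsto_ae
  exact ⟨ns, hns⟩

theorem isClosed_ker_mulOp (w : X → ℂ) :
    IsClosed (PartialOp.ker (mulOp μ w) : Set (Lp ℂ 2 μ)) := by
  refine IsSeqClosed.isClosed fun f g hf hg => ?_
  obtain ⟨ns, hns⟩ := Lp.exists_subseq_tendsto_ae hg
  refine mem_ker_mulOp.2 ?_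
  filter_upwards [hns, ae_all_iff.2 fun n => mem_ker_mulOp.1 (hf n)] with x h1 h2
  refine tendsto_nhds_unique (h1.const_mul (w x)) ?_
  simp only [h2, tendsto_const_nhds]

theorem isClosed_ker_compOp {φ : X → X} (hφ : Measure.QuasiMeasurePreserving φ μ μ) :
    IsClosed (PartialOp.ker (compOp hφ) : Set (Lp ℂ 2 μ)) := by
  refine IsSeqClosed.isClosed fun f g hf hg => ?_
  obtain ⟨ns, hns⟩ := Lp.exists_subseq_tendsto_ae hg
  refine mem_ker_compOp.2 ?_
  -- Since `μ ∘ φ⁻¹ ≪ μ`, a.e. convergence survives composition with `φ`.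
  filter_upwards [hφ.ae hns, ae_all_iff.2 fun n => mem_ker_compOp.1 (hf n)] with x h1 h2
  refine tendsto_nhds_unique h1 ?_
  simp only [h2, tendsto_const_nhds]

/-! ### Density of the ranges of `C_φ` and `M_w C_φ`. -/

/-- If `C_φ` is densely defined, the space is covered, up to a null set, by countably many sets of
finite measure whose preimages have finite measure. -/
theorem exists_cover_of_dense_domain [SigmaFinite μ] {φ : X → X}
    (hφ : Measure.QuasiMeasurePreserving φ μ μ)
    (hdense : Dense ((compOp hφ).domain : Set (Lp ℂ 2 μ))) :
    ∃ A : ℕ → Set X, (∀ n, MeasurableSet (A n) ∧ μ (A n) < ∞ ∧ μ (φ ⁻¹' A n) < ∞) ∧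
      ∀ᵐ x ∂μ, ∃ n, x ∈ A n := by
  have key : ∀ k, ∃ A : ℕ → Set X,
      (∀ n, MeasurableSet (A n) ∧ μ (A n) < ∞ ∧ μ (φ ⁻¹' A n) < ∞) ∧
      ∀ᵐ x ∂μ, x ∈ spanningSets μ k → ∃ n, x ∈ A n := by
    intro k
    obtain ⟨f, hf, hlim⟩ := mem_closure_iff_seq_limit.1 (hdense (indicatorConstLp 2
      (measurableSet_spanningSets μ k) (measure_spanningSets_lt_top μ k).ne (1 : ℂ)))
    obtain ⟨ns, hns⟩ := Lp.exists_subseq_tendsto_ae hlim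
    -- Any threshold strictly between 0 and 1 works: Chebyshev bounds the level sets of `f` and of
    -- `f ∘ φ`, while the approximants tend to 1 a.e. on the spanning set.
    have h2 : (2⁻¹ : NNReal) ≠ 0 := by norm_num
    refine ⟨fun n => {x | (2⁻¹ : NNReal) ≤ ‖f (ns n) x‖₊}, fun n => ⟨?_, ?_, ?_⟩, ?_⟩
    · exact measurableSet_le measurable_const (Lp.stronglyMeasurable _).nnnorm.measurable
    · exact (Lp.memLp (f (ns n))).meas_ge_lt_top two_ne_zero ENNReal.ofNat_ne_top h2
    · exact MemLp.meas_ge_lt_top (show MemLp (fun x => f (ns n) (φ x)) 2 μ from hf (ns n))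
        two_ne_zero ENNReal.ofNat_ne_top h2
    · filter_upwards [hns, indicatorConstLp_coeFn (μ := μ) (p := 2) (c := (1 : ℂ))
        (hs := measurableSet_spanningSets μ k)
        (hμs := (measure_spanningSets_lt_top μ k).ne)] with x h1 h3 hx
      rw [h3, Set.indicator_of_mem hx] at h1
      have h4 : ∀ᶠ n in atTop, (2⁻¹ : NNReal) < ‖f (ns n) x‖₊ :=
        h1.nnnorm.eventually_const_lt (by rw [nnnorm_one]; norm_num)
      obtain ⟨n, hn⟩ := h4.exists
      exact ⟨n, hn.le⟩
  choose A hA hcov using key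
  refine ⟨fun n => A n.unpair.1 n.unpair.2, fun n => hA _ _, ?_⟩
  filter_upwards [ae_all_iff.2 hcov] with x hx
  obtain ⟨k, hk⟩ : ∃ k, x ∈ spanningSets μ k := by
    rw [← Set.mem_iUnion, iUnion_spanningSets]
    trivial
  obtain ⟨n, hn⟩ := hx k hk
  exact ⟨Nat.pair k n, by simpa using hn⟩

theorem memLp_indicator_of_norm_le {A : Set X} (hA : MeasurableSet A) (hμA : μ A < ∞)
    {g : X → ℂ} (hg : AEStronglyMeasurable g μ) (c : ℝ) (hc : ∀ x ∈ A, ‖g x‖ ≤ c) :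
    MemLp (A.indicator g) 2 μ := by
  rw [memLp_indicator_iff_restrict hA]
  have : IsFiniteMeasure (μ.restrict A) := isFiniteMeasure_restrict.2 hμA.ne
  exact MemLp.of_bound hg.restrict c
    ((ae_restrict_iff' hA).2 (Eventually.of_forall hc))

/-- Suppose that every vector factors through `φ`. If `h` is orthogonal to all `w · (f ∘ φ)` that
lie in `L²(μ)`, where `f` is in the domain of `C_φ`, then `w h = 0`. -/
theorem mul_ae_eq_zero_of_orthogonal {φ : X → X} (hφ : Measure.QuasiMeasurePreserving φ μ μ)
    {A : ℕ → Set X} (hA : ∀ n, MeasurableSet (A n) ∧ μ (A n) < ∞ ∧ μ (φ ⁻¹' A n) < ∞)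
    (hcov : ∀ᵐ x ∂μ, ∃ n, x ∈ A n)
    (hfact : ∀ f : Lp ℂ 2 μ, ∃ g : X → ℂ, Measurable g ∧ f =ᵐ[μ] g ∘ φ)
    {w : X → ℂ} (hw : Measurable w) (h : Lp ℂ 2 μ)
    (horth : ∀ f ∈ (compOp hφ).domain, ∀ hf : MemLp (fun x => w x * f (φ x)) 2 μ,
      inner ℂ (hf.toLp _) h = 0) :
    ∀ᵐ x ∂μ, w x * h x = 0 := by
  have hwn : ∀ n : ℕ, MeasurableSet {x | ‖w x‖ ≤ n} := fun n =>
    measurableSet_le hw.norm measurable_const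
  have key : ∀ n : ℕ, ∀ᵐ x ∂μ, ‖w x‖ ≤ n → w x * h x = 0 := by
    intro n
    -- Truncating where `‖w x‖ ≤ n` keeps `star w * h` in `L²`, so that it factors through `φ`.
    set u : X → ℂ := {x | ‖w x‖ ≤ n}.indicator (fun x => star (w x) * h x) with hu
    have hum : AEStronglyMeasurable u μ :=
      ((continuous_star.measurable.comp hw).aestronglyMeasurable.mul
        (Lp.aestronglyMeasurable h)).indicator (hwn n)
    have huL : MemLp u 2 μ := by
      refine (Lp.memLp h).of_le_mul (c := n) hum (Eventually.of_forall fun x => ?_)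
      by_cases hx : ‖w x‖ ≤ n
      · rw [hu, Set.indicator_of_mem (show x ∈ {x | ‖w x‖ ≤ n} from hx), norm_mul, norm_star]
        gcongr
      · rw [hu, Set.indicator_of_notMem (show x ∉ {x | ‖w x‖ ≤ n} from hx), norm_zero]
        positivity
    obtain ⟨g, hg, hgu⟩ := hfact (huL.toLp u)
    have hug : u =ᵐ[μ] g ∘ φ := huL.coeFn_toLp.symm.trans hgu
    have hzero : ∀ i m : ℕ, ∀ᵐ x ∂μ, φ x ∈ A i → ‖g (φ x)‖ ≤ m → u x = 0 := by
      intro i m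
      -- Cutting `g` down to `B` gives a bounded test function in the domain of `C_φ`.
      set B : Set X := A i ∩ {y | ‖g y‖ ≤ m}
      have hBm : MeasurableSet B := (hA i).1.inter (measurableSet_le hg.norm measurable_const)
      have hf0 : MemLp (B.indicator g) 2 μ :=
        memLp_indicator_of_norm_le hBm ((measure_mono Set.inter_subset_left).trans_lt (hA i).2.1)
          hg.aestronglyMeasurable m fun x hx => hx.2
      have hf1 : MemLp ((φ ⁻¹' B).indicator (g ∘ φ)) 2 μ :=
        memLp_indicator_of_norm_le (hφ.measurable hBm)
          ((measure_mono (Set.preimage_mono Set.inter_subset_left)).trans_lt (hA i).2.2)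
          (hg.comp hφ.measurable).aestronglyMeasurable m fun x hx => hx.2
      have hcomp : (fun x => hf0.toLp _ (φ x)) =ᵐ[μ] (φ ⁻¹' B).indicator (g ∘ φ) := by
        filter_upwards [hφ.ae hf0.coeFn_toLp] with x hx
        rw [hx]
        rfl
      have hdom : hf0.toLp _ ∈ (compOp hφ).domain := hf1.ae_eq hcomp.symm
      have hval : (fun x => hf0.toLp _ (φ x)) =ᵐ[μ] (φ ⁻¹' B).indicator u := by
        filter_upwards [hcomp, hug] with x h1 h2
        rw [h1]
        by_cases hx : x ∈ φ ⁻¹' B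
        · rw [Set.indicator_of_mem hx, Set.indicator_of_mem hx, h2]
        · rw [Set.indicator_of_notMem hx, Set.indicator_of_notMem hx]
      have hwf : MemLp (fun x => w x * hf0.toLp _ (φ x)) 2 μ := by
        refine huL.of_le_mul (c := n)
          (hw.aestronglyMeasurable.mul (hf1.ae_eq hcomp.symm).aestronglyMeasurable) ?_
        filter_upwards [hval] with x h1
        rw [h1, norm_mul]
        by_cases hx : ‖w x‖ ≤ n
        · exact mul_le_mul hx (norm_indicator_le_norm_self _ _) (norm_nonneg _)
            (Nat.cast_nonneg n)
        · have hux : u x = 0 := Set.indicator_of_notMem (show x ∉ {x | ‖w x‖ ≤ n} from hx) _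
          have : (φ ⁻¹' B).indicator u x = 0 := by
            classical rw [Set.indicator_apply, hux, ite_self]
          rw [this, hux]
          simp
      -- Pairing `w · 1_{φ⁻¹(B)} u` with `h` gives the integral of `‖u‖²` over `φ⁻¹(B)`, because
      -- `star w * h = u` where `‖w‖ ≤ n` and `u = 0` elsewhere.
      have hself : inner ℂ (hf1.toLp _) (hf1.toLp _) = 0 := by
        rw [← horth _ hdom hwf, L2.inner_def, L2.inner_def]
        refine integral_congr_ae ?_
        filter_upwards [hf1.coeFn_toLp, hwf.coeFn_toLp, hcomp, hval] with x h1 h2 h3 h4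
        rw [h1, h2, ← h3, h4]
        by_cases hx : x ∈ φ ⁻¹' B ∧ ‖w x‖ ≤ n
        · rw [Set.indicator_of_mem hx.1, hu,
            Set.indicator_of_mem (show x ∈ {x | ‖w x‖ ≤ n} from hx.2)]
          simp only [RCLike.inner_apply, map_mul, RCLike.star_def,
            RingHomCompTriple.comp_apply]
          ring
        · have : (φ ⁻¹' B).indicator u x = 0 := by
            by_cases h5 : x ∈ φ ⁻¹' B
            · rw [Set.indicator_of_mem h5]
              exact Set.indicator_of_notMem (fun h6 : x ∈ {x | ‖w x‖ ≤ n} => hx ⟨h5, h6⟩) _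
            · exact Set.indicator_of_notMem h5 _
          rw [this]
          simp
      filter_upwards [Lp.ae_of_eq_zero (inner_self_eq_zero.1 hself), hf1.coeFn_toLp, hug]
        with x h1 h2 h3 h4 h5
      rw [h3, ← h1, h2, Set.indicator_of_mem (show x ∈ φ ⁻¹' B from ⟨h4, h5⟩)]
    filter_upwards [hφ.ae hcov, ae_all_iff.2 fun i => ae_all_iff.2 (hzero i)] with x h1 h2 h3
    obtain ⟨i, hi⟩ := h1
    obtain ⟨m, hm⟩ := exists_nat_ge ‖g (φ x)‖
    have h4 := h2 i m hi hm
    rw [hu, Set.indicator_of_mem (show x ∈ {x | ‖w x‖ ≤ n} from h3)] at h4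
    simpa using h4
  filter_upwards [ae_all_iff.2 key] with x hx
  obtain ⟨n, hn⟩ := exists_nat_ge ‖w x‖
  exact hx n hn

theorem orthogonal_ran_compOp_eq_bot {φ : X → X} (hφ : Measure.QuasiMeasurePreserving φ μ μ)
    {A : ℕ → Set X} (hA : ∀ n, MeasurableSet (A n) ∧ μ (A n) < ∞ ∧ μ (φ ⁻¹' A n) < ∞)
    (hcov : ∀ᵐ x ∂μ, ∃ n, x ∈ A n)
    (hfact : ∀ f : Lp ℂ 2 μ, ∃ g : X → ℂ, Measurable g ∧ f =ᵐ[μ] g ∘ φ) :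
    (PartialOp.ran (compOp hφ))ᗮ = ⊥ := by
  refine eq_bot_iff.2 fun h hh => Lp.eq_zero_of_ae ?_
  have := mul_ae_eq_zero_of_orthogonal hφ hA hcov hfact (w := 1) measurable_one h ?_
  · simpa using this
  · intro f hf hf'
    rw [← hh _ ⟨⟨f, hf⟩, rfl⟩]
    congr 1
    exact MemLp.toLp_congr hf' hf (Eventually.of_forall fun x => one_mul _)

theorem orthogonal_ran_mul_eq_bot {φ : X → X} (hφ : Measure.QuasiMeasurePreserving φ μ μ)
    {A : ℕ → Set X} (hA : ∀ n, MeasurableSet (A n) ∧ μ (A n) < ∞ ∧ μ (φ ⁻¹' A n) < ∞)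
    (hcov : ∀ᵐ x ∂μ, ∃ n, x ∈ A n)
    (hfact : ∀ f : Lp ℂ 2 μ, ∃ g : X → ℂ, Measurable g ∧ f =ᵐ[μ] g ∘ φ)
    {w : X → ℂ} (hw : Measurable w) (hw0 : ∀ᵐ x ∂μ, w x ≠ 0) :
    (PartialOp.ran (PartialOp.mul (mulOp μ w) (compOp hφ)))ᗮ = ⊥ := by
  refine eq_bot_iff.2 fun h hh => Lp.eq_zero_of_ae ?_
  have := mul_ae_eq_zero_of_orthogonal hφ hA hcov hfact hw h ?_
  · filter_upwards [this, hw0] with x h1 h2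
    exact (mul_eq_zero.1 h1).resolve_left h2
  · intro f hf hf'
    have hae : (fun x => w x * compOp hφ ⟨f, hf⟩ x) =ᵐ[μ] fun x => w x * f (φ x) := by
      filter_upwards [compOp_apply_ae (hφ := hφ) ⟨f, hf⟩] with x hx
      rw [hx]
    have hd : f ∈ (PartialOp.mul (mulOp μ w) (compOp hφ)).domain :=
      (PartialOp.mem_mul_domain _ _ f).2 ⟨hf, hf'.ae_eq hae.symm⟩
    rw [← hh _ ⟨⟨f, hd⟩, rfl⟩]
    congr 1
    exact MemLp.toLp_congr hf' (hf'.ae_eq hae.symm) hae.symm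

/-! ### Factorization through `φ` and non-vanishing of `w`. -/

theorem exists_comp_of_mem_lpMeas {φ : X → X} {f : Lp ℂ 2 μ}
    (hf : f ∈ lpMeas ℂ ℂ (MeasurableSpace.comap φ inferInstance) 2 μ) :
    ∃ g : X → ℂ, Measurable g ∧ f =ᵐ[μ] g ∘ φ := by
  obtain ⟨f', hf', hae⟩ := mem_lpMeas_iff_aestronglyMeasurable.1 hf
  obtain ⟨g, hg, rfl⟩ := hf'.measurable.exists_eq_measurable_comp
  exact ⟨g, hg, hae⟩

/-- The a.e. `φ⁻¹(𝒜)`-measurable functions form a closed subset of `L²` that contains `R(C_φ)`. -/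
theorem exists_comp_of_dense_ran {φ : X → X} (hφ : Measure.QuasiMeasurePreserving φ μ μ)
    (hd : Dense (PartialOp.ran (compOp hφ) : Set (Lp ℂ 2 μ))) (f : Lp ℂ 2 μ) :
    ∃ g : X → ℂ, Measurable g ∧ f =ᵐ[μ] g ∘ φ := by
  refine exists_comp_of_mem_lpMeas ?_
  rw [mem_lpMeas_iff_aestronglyMeasurable]
  refine closure_minimal (t := {f : Lp ℂ 2 μ |
    AEStronglyMeasurable[MeasurableSpace.comap φ inferInstance] f μ}) ?_
    (isClosed_aestronglyMeasurable hφ.measurable.comap_le) (hd f)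
  rintro _ ⟨g, rfl⟩
  exact ⟨_, (Lp.stronglyMeasurable (g : Lp ℂ 2 μ)).comp_measurable
    (comap_measurable φ), compOp_apply_ae g⟩

/-- For the projection `P` defining `E_φ`, `f - P f` always lies in the kernel, so injectivity
forces `f = P f`. -/
theorem exists_comp_of_condExpMap_injective {φ : X → X}
    (hφ : Measure.QuasiMeasurePreserving φ μ μ)
    (hinj : ∀ f : Lp ℂ 2 μ, condExpMap hφ f = 0 → f = 0) (f : Lp ℂ 2 μ) :
    ∃ g : X → ℂ, Measurable g ∧ f =ᵐ[μ] g ∘ φ := by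
  set P := condExpL2 ℂ ℂ (μ := μ) (m := MeasurableSpace.comap φ inferInstance)
    hφ.measurable.comap_le
  have hPf : P (P f : Lp ℂ 2 μ) = P f := by
    have : Fact ((MeasurableSpace.comap φ inferInstance) ≤ ‹MeasurableSpace X›) :=
      ⟨hφ.measurable.comap_le⟩
    exact Submodule.orthogonalProjectionOnto_mem_subspace_eq_self (P f)
  have h0 : f - (P f : Lp ℂ 2 μ) = 0 := by
    refine hinj _ ?_
    have : P (f - (P f : Lp ℂ 2 μ)) = 0 := by rw [map_sub, hPf, sub_self]
    exact congrArg Subtype.val this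
  have h1 : f = (P f : Lp ℂ 2 μ) := sub_eq_zero.1 h0
  rw [h1]
  exact exists_comp_of_mem_lpMeas (P f).2

/-- If `N(M_w)` is contained in the kernel of the conditional expectation, then `w` does not
vanish. -/
theorem ae_ne_zero_of_ker_le {φ : X → X} (hφ : Measure.QuasiMeasurePreserving φ μ μ)
    {A : ℕ → Set X} (hA : ∀ n, MeasurableSet (A n) ∧ μ (A n) < ∞ ∧ μ (φ ⁻¹' A n) < ∞)
    (hcov : ∀ᵐ x ∂μ, ∃ n, x ∈ A n) {w : X → ℂ} (hw : Measurable w)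
    (hker : ∀ f ∈ PartialOp.ker (mulOp μ w), condExpMap hφ f =ᵐ[μ] 0) :
    ∀ᵐ x ∂μ, w x ≠ 0 := by
  have key : ∀ n, ∀ᵐ x ∂μ, φ x ∈ A n → w x ≠ 0 := by
    intro n
    obtain ⟨hAm, -, hAf⟩ := hA n
    set S : Set X := φ ⁻¹' A n ∩ {x | w x = 0}
    have hSm : MeasurableSet S := (hφ.measurable hAm).inter (hw (measurableSet_singleton 0))
    have hSf : μ S ≠ ∞ := ((measure_mono Set.inter_subset_left).trans_lt hAf).ne
    have hk : indicatorConstLp 2 hSm hSf (1 : ℂ) ∈ PartialOp.ker (mulOp μ w) := by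
      refine mem_ker_mulOp.2 ?_
      filter_upwards [indicatorConstLp_coeFn (μ := μ) (p := 2) (hs := hSm) (hμs := hSf)
        (c := (1 : ℂ))] with x hx
      rw [hx]
      by_cases h : x ∈ S
      · rw [h.2, zero_mul]
      · rw [Set.indicator_of_notMem h, mul_zero]
    -- The conditional expectation of the indicator of `S` has integral `μ S` over `φ⁻¹(A n)`, yet
    -- it vanishes a.e.
    have h1 := integral_condExpL2_eq (𝕜 := ℂ) hφ.measurable.comap_le
      (indicatorConstLp 2 hSm hSf (1 : ℂ)) ⟨A n, hAm, rfl⟩ hAf.ne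
    rw [setIntegral_indicatorConstLp (hφ.measurable hAm)] at h1
    have h2 : ∫ x in φ ⁻¹' A n, condExpMap hφ (indicatorConstLp 2 hSm hSf (1 : ℂ)) x ∂μ = 0 :=
      integral_eq_zero_of_ae (ae_restrict_of_ae (hker _ hk))
    have h3 := h1.symm.trans h2
    rw [Set.inter_eq_self_of_subset_left Set.inter_subset_left] at h3
    have h4 : μ S = 0 := by
      rw [smul_eq_zero_iff_left one_ne_zero, measureReal_eq_zero_iff hSf] at h3
      exact h3
    filter_upwards [measure_eq_zero_iff_ae_notMem.1 h4] with x hx h5 h6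
    exact hx ⟨h5, h6⟩
  filter_upwards [hφ.ae hcov, ae_all_iff.2 key] with x ⟨n, hn⟩ h
  exact h n hn

end MeasureTheory

theorem corollary10 {X : Type*} [MeasurableSpace X] (μ : Measure X) [SigmaFinite μ]
    (φ : X → X) (hφ : Measure.QuasiMeasurePreserving φ μ μ)
    (w : X → ℂ) (hw : Measurable w)
    (hdense : Dense ((compOp hφ).domain : Set (Lp ℂ 2 μ))) :
    (PartialOp.HasReciprocal (compOp hφ) ∧ PartialOp.HasReciprocal (mulOp μ w)) ∧
    ({f : Lp ℂ 2 μ | condExpMap hφ f =ᵐ[μ] 0} = (PartialOp.ker (mulOp μ w) : Set (Lp ℂ 2 μ)) →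
      PartialOp.HasReciprocal (PartialOp.mul (mulOp μ w) (compOp hφ)) ∧
      PartialOp.reciprocal (PartialOp.mul (mulOp μ w) (compOp hφ)) =
        PartialOp.mul (PartialOp.reciprocal (compOp hφ)) (PartialOp.reciprocal (mulOp μ w))) ∧
    ((∀ᵐ x ∂μ, w x ≠ 0) → Dense (PartialOp.ran (compOp hφ) : Set (Lp ℂ 2 μ)) →
      PartialOp.HasReciprocal (PartialOp.mul (mulOp μ w) (compOp hφ)) ∧
      PartialOp.reciprocal (PartialOp.mul (mulOp μ w) (compOp hφ)) =
        PartialOp.mul (PartialOp.reciprocal (compOp hφ)) (PartialOp.reciprocal (mulOp μ w))) := by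
  obtain ⟨A, hA, hcov⟩ := exists_cover_of_dense_domain hφ hdense
  have hC := PartialOp.hasReciprocal_of_isClosed_ker (isClosed_ker_compOp hφ)
  have hM := PartialOp.hasReciprocal_of_isClosed_ker (isClosed_ker_mulOp (μ := μ) w)
  have hkM : (∀ᵐ x ∂μ, w x ≠ 0) → PartialOp.ker (mulOp μ w) = ⊥ := fun hw0 =>
    eq_bot_iff.2 fun f hf => Lp.eq_zero_of_ae <| by
      filter_upwards [mem_ker_mulOp.1 hf, hw0] with x h1 h2
      exact (mul_eq_zero.1 h1).resolve_left h2
  have main : (∀ᵐ x ∂μ, w x ≠ 0) →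
      (∀ f : Lp ℂ 2 μ, ∃ g : X → ℂ, Measurable g ∧ f =ᵐ[μ] g ∘ φ) →
      PartialOp.HasReciprocal (PartialOp.mul (mulOp μ w) (compOp hφ)) ∧
      PartialOp.reciprocal (PartialOp.mul (mulOp μ w) (compOp hφ)) =
        PartialOp.mul (PartialOp.reciprocal (compOp hφ)) (PartialOp.reciprocal (mulOp μ w)) := by
    intro hw0 hfact
    have h := (PartialOp.isReciprocal_reciprocal hC).mul (PartialOp.isReciprocal_reciprocal hM)
      (isClosed_ker_compOp hφ) (hkM hw0) (orthogonal_ran_compOp_eq_bot hφ hA hcov hfact)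
      (orthogonal_ran_mul_eq_bot hφ hA hcov hfact hw hw0)
    exact ⟨⟨_, h⟩, h.reciprocal_eq⟩
  refine ⟨⟨hC, hM⟩, fun hE => ?_, fun hw0 hd => main hw0 (exists_comp_of_dense_ran hφ hd)⟩
  -- The inclusion of `N(M_w)` in the kernel of `E_φ` gives `w ≠ 0` a.e.; the reverse one then makes
  -- `E_φ` injective.
  have hw0 := ae_ne_zero_of_ker_le hφ hA hcov hw fun f hf => hE.superset hf
  refine main hw0 (exists_comp_of_condExpMap_injective hφ fun f hf => ?_)
  have hf' : f ∈ PartialOp.ker (mulOp μ w) := hE.subset (Lp.eq_zero_iff_ae_eq_zero.1 hf)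
  rwa [hkM hw0] at hf'
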